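/- Let $S$ be a finite alphabet, and let $X \subset S^{\mathbb N}$ be a one-sided subshift, i.e. a subset that is closed in the product topology ($S$ discrete) and satisfies $\sigma(X) \subseteq X$, where $\sigma(x)_i = x_{i+1}$ (surjectivity of $\sigma$ on $X$ is not required). Suppose that $X$ is recursive, i.e. the set of finite words over $S$ that occur in points of $X$ is recursive, and that $X$ is quasiminimal, i.e. only finitely many subshifts are properly contained in $X$. Then $X$ is decidable, i.e. its model-checking problem for Muller automata is decidable: there is an algorithm which, given (a finite description of) a Muller automaton over $S$, decides whether $X$ contains a point accepted by the automaton. Here a Muller automaton $A = (Q, q_0, \delta, \mathcal F)$ consists of a finite set of states $Q$, an initial state $q_0 \in Q$, a transition function $\delta : Q \times S \to Q$ and a family $\mathcal F$ of subsets of $Q$; it accepts $x \in S^{\mathbb N}$ if the set of states visited infinitely often by its run $q_{i+1} = \delta(q_i, x_i)$ belongs to $\mathcal F$. -/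

import Mathlib

namespace OneSided

/-- The shift map `σ(x)_i = x_{i+1}` on one-sided sequences. -/
def shift {S : Type*} (x : ℕ → S) : ℕ → S := fun i => x (i + 1)

/-- An `ℕ`-subshift over the (finite, discrete) alphabet `S`: a closed subset of `S^ℕ` (with the
product topology) which is mapped into itself by the shift. Surjectivity of the shift is not
required, and the empty set is a subshift. -/
def IsSubshift {S : Type*} [TopologicalSpace S] (X : Set (ℕ → S)) : Prop :=
  IsClosed X ∧ Set.MapsTo shift X X

/-- The word `w` occurs in the sequence `x`, that is, `x_{[i, i+|w|-1]} = w` for some `i`. -/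
def Occurs {S : Type*} (w : List S) (x : ℕ → S) : Prop :=
  ∃ i : ℕ, (List.range w.length).map (fun j => x (i + j)) = w

/-- The language of `X`: all finite words that occur in some point of `X`. -/
def language {S : Type*} (X : Set (ℕ → S)) : Set (List S) :=
  {w | ∃ x ∈ X, Occurs w x}

/-- `X` is recursive: its language is a recursive set of words. -/
def IsRecursive {S : Type*} [Primcodable S] (X : Set (ℕ → S)) : Prop :=
  ComputablePred fun w : List S => w ∈ language X

/-- `X` is quasiminimal: it has only finitely many proper subshifts. -/
def IsQuasiminimal {S : Type*} [TopologicalSpace S] (X : Set (ℕ → S)) : Prop :=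
  {Y : Set (ℕ → S) | IsSubshift Y ∧ Y ⊂ X}.Finite

/-- A Muller automaton over the alphabet `S`: finitely many states `0, …, numStates - 1`, an
initial state, a transition function, and a finite family (table) of sets of states. -/
structure MullerAutomaton (S : Type*) where
  numStates : ℕ
  init : Fin numStates
  step : Fin numStates → S → Fin numStates
  table : Finset (Finset (Fin numStates))

/-- The state of the automaton after reading the first `i` letters of `x`. -/
def MullerAutomaton.run {S : Type*} (A : MullerAutomaton S) (x : ℕ → S) : ℕ → Fin A.numStates
  | 0 => A.init
  | i + 1 => A.step (A.run x i) (x i)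

/-- Muller acceptance: the set of states visited infinitely often belongs to the table. -/
def MullerAutomaton.Accepts {S : Type*} (A : MullerAutomaton S) (x : ℕ → S) : Prop :=
  ∃ F ∈ A.table, ∀ q : Fin A.numStates, q ∈ F ↔ {i : ℕ | A.run x i = q}.Infinite

/-- Finite descriptions of Muller automata, the inputs of the model-checking problem: the number
of states, the initial state, the list of all transitions `((p, a), δ(p, a))`, and the table as a
list of lists of states. -/
abbrev MullerCode (S : Type*) := ℕ × ℕ × List ((ℕ × S) × ℕ) × List (List ℕ)

/-- The code `c` is a description of the automaton `A`. -/
def MullerAutomaton.IsDescribedBy {S : Type*} (A : MullerAutomaton S) (c : MullerCode S) : Prop :=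
  c.1 = A.numStates ∧
  c.2.1 = A.init ∧
  (∀ e : (ℕ × S) × ℕ, e ∈ c.2.2.1 ↔
    ∃ (p : Fin A.numStates) (a : S), e = (((p : ℕ), a), (A.step p a : ℕ))) ∧
  (∀ l ∈ c.2.2.2, ∀ q ∈ l, q < A.numStates) ∧
  (∀ F : Finset (Fin A.numStates), F ∈ A.table ↔
    ∃ l ∈ c.2.2.2, ∀ q : Fin A.numStates, q ∈ F ↔ (q : ℕ) ∈ l)

/-- Every Muller automaton over a finite alphabet has a description. -/
theorem MullerAutomaton.exists_isDescribedBy {S : Type*} [Finite S] (A : MullerAutomaton S) :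
    ∃ c : MullerCode S, A.IsDescribedBy c := by
  classical
  have := Fintype.ofFinite S
  refine ⟨(A.numStates, A.init,
    (Finset.univ : Finset (Fin A.numStates × S)).toList.map
      (fun t => (((t.1 : ℕ), t.2), (A.step t.1 t.2 : ℕ))),
    A.table.toList.map (fun F => F.toList.map (fun q : Fin A.numStates => (q : ℕ)))), rfl, rfl, ?_, ?_, ?_⟩
  · intro e
    simp only [List.mem_map, Finset.mem_toList, Finset.mem_univ, true_and, Prod.exists]
    exact ⟨fun ⟨p, a, h⟩ => ⟨p, a, h.symm⟩, fun ⟨p, a, h⟩ => ⟨p, a, h.symm⟩⟩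
  · intro l hl q hq
    simp only [List.mem_map] at hl
    obtain ⟨F, -, rfl⟩ := hl
    simp only [List.mem_map] at hq
    obtain ⟨q', -, rfl⟩ := hq
    exact q'.isLt
  · intro F
    have key : ∀ (G : Finset (Fin A.numStates)) (q : Fin A.numStates),
        (q : ℕ) ∈ G.toList.map (fun q : Fin A.numStates => (q : ℕ)) ↔ q ∈ G := by
      intro G q
      simp only [List.mem_map, Finset.mem_toList]
      exact ⟨fun ⟨q', h, e⟩ => Fin.ext e ▸ h, fun h => ⟨q, h, rfl⟩⟩
    constructor
    · intro hF
      exact ⟨_, List.mem_map.2 ⟨F, Finset.mem_toList.2 hF, rfl⟩, fun q => (key F q).symm⟩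
    · rintro ⟨l, hl, h⟩
      obtain ⟨G, hG, rfl⟩ := List.mem_map.1 hl
      have : F = G := Finset.ext fun q => (h q).trans (key G q)
      exact this ▸ Finset.mem_toList.1 hG

/-- `X` is decidable: its model-checking problem for Muller automata is decidable, that is, there
is an algorithm which, given any description of a Muller automaton over the alphabet `S`, decides
whether the automaton accepts some point of `X`. -/
def IsDecidable {S : Type*} [Primcodable S] (X : Set (ℕ → S)) : Prop :=
  ∃ P : MullerCode S → Prop, ComputablePred P ∧
    ∀ (A : MullerAutomaton S) (c : MullerCode S), A.IsDescribedBy c →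
      (P c ↔ ∃ x ∈ X, A.Accepts x)

end OneSided

open Set PiNat

namespace OneSided

/-! ### Runs of finite transition systems on recurrent sets of sequences. -/

section Dynamics

variable {S Q : Type*}

/-! Only finitely many subshifts lie in `X`, so the decreasing chain `shift^[k] '' X` stabilises at
some `Y` on which the shift is surjective. Finiteness gives two kinds of recurrence on `Y`: each
point is a limit of its own later shifts (`mem_orbitClosure_shift`), hence by compactness prefixes
return with bounded gaps (`boundedReturns`); and each point lies in the orbit closure of all points
near it (`locallyApproached`). Therefore, for each finite transition system, one `N` works for all
points of `Y` and all starting states: after time `N`, every state still visited is met in every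
window of length `N` (`exists_eventuallyWindowed`).

Muller acceptance on `X` is thus determined by a bounded prefix. The bound is not computed from the
automaton but searched for: `WindowsAgree`, tested on all words of length `k + 2 * n` in the
language, certifies `n` (`infinite_setOf_runFrom_iff`), and some `n` passes (`exists_windowsAgree`).
Recursiveness of the language makes both the test and the final inspection of words effective; `k`
is a constant depending only on `X`. -/

theorem iterate_shift_apply (x : ℕ → S) (n i : ℕ) : shift^[n] x i = x (i + n) := by
  induction n generalizing x with
  | zero => rfl
  | succ n ih => rw [Function.iterate_succ_apply, ih]; simp only [shift]; congr 1

/-- The states visited by a transition function reading `x` from the state `q`. -/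
def runFrom (δ : Q → S → Q) (q : Q) (x : ℕ → S) : ℕ → Q
  | 0 => q
  | i + 1 => δ (runFrom δ q x i) (x i)

theorem runFrom_add (δ : Q → S → Q) (q : Q) (x : ℕ → S) (i j : ℕ) :
    runFrom δ q x (i + j) = runFrom δ (runFrom δ q x i) (shift^[i] x) j := by
  induction j with
  | zero => rfl
  | succ j ih => rw [← add_assoc, runFrom, runFrom, ih, iterate_shift_apply, add_comm i j]

theorem runFrom_congr (δ : Q → S → Q) (q : Q) {x y : ℕ → S} {ℓ i : ℕ}
    (h : y ∈ cylinder x ℓ) (hi : i ≤ ℓ) : runFrom δ q y i = runFrom δ q x i := by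
  induction i with
  | zero => rfl
  | succ i ih => rw [runFrom, runFrom, ih (by omega), h i (by omega)]

theorem iterate_shift_mem_cylinder {x y : ℕ → S} {j ℓ : ℕ} (h : y ∈ cylinder x (j + ℓ)) :
    shift^[j] y ∈ cylinder (shift^[j] x) ℓ := fun i hi => by
  rw [iterate_shift_apply, iterate_shift_apply]
  exact h _ (by omega)

theorem mem_cylinder_trans {x y z : ℕ → S} {m n : ℕ} (hz : z ∈ cylinder y m)
    (hy : y ∈ cylinder x n) (h : n ≤ m) : z ∈ cylinder x n := fun i hi => by
  rw [hz i (by omega), hy i hi]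

/-- Every word returns with bounded gaps in the points of `Y` that begin with it. -/
def BoundedReturns (Y : Set (ℕ → S)) : Prop :=
  ∀ x ∈ Y, ∀ ℓ, ∃ n, ∀ z ∈ Y ∩ cylinder x ℓ, ∀ i, ∃ j, i ≤ j ∧ j ≤ i + n ∧ shift^[j] z ∈ cylinder x ℓ

/-- Every point of `Y` lies in the orbit closure of all points of `Y` close to it. -/
def LocallyApproached (Y : Set (ℕ → S)) : Prop :=
  ∀ x ∈ Y, ∃ ℓ, ∀ y ∈ Y ∩ cylinder x ℓ, ∀ m, ∃ j, shift^[j] y ∈ cylinder x m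

/-- The pairs `(p, f)` such that `f` can be reached from `p` by reading a point of `Y` that agrees
with `y` up to `ℓ`, at time `ℓ` or later. -/
def futureStates (δ : Q → S → Q) (Y : Set (ℕ → S)) (y : ℕ → S) (ℓ : ℕ) : Set (Q × Q) :=
  {pf | ∃ w ∈ Y ∩ cylinder y ℓ, ∃ i, ℓ ≤ i ∧ runFrom δ pf.1 w i = pf.2}

/-- The pairs `(p, f)` such that reading `y` from `p` visits `f` between the times `ℓ` and `m`. -/
def windowStates (δ : Q → S → Q) (y : ℕ → S) (ℓ m : ℕ) : Set (Q × Q) :=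
  {pf | ∃ i, ℓ ≤ i ∧ i ≤ m ∧ runFrom δ pf.1 y i = pf.2}

theorem futureStates_anti (δ : Q → S → Q) (Y : Set (ℕ → S)) {y w : ℕ → S} {ℓ m : ℕ}
    (hw : w ∈ cylinder y ℓ) (h : ℓ ≤ m) : futureStates δ Y w m ⊆ futureStates δ Y y ℓ := by
  rintro pf ⟨v, ⟨hv, hvw⟩, i, hi, e⟩
  exact ⟨v, ⟨hv, mem_cylinder_trans hvw hw h⟩, i, h.trans hi, e⟩

/-- Longer prefixes can only lose future pairs, and there are finitely many sets of pairs, so a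
minimal one cannot shrink further. Pairs handle all starting states at once. -/
theorem exists_stable_word [Finite Q] (δ : Q → S → Q) (Y : Set (ℕ → S)) {z : ℕ → S} (hz : z ∈ Y)
    (ℓ₀ : ℕ) : ∃ y ∈ Y ∩ cylinder z ℓ₀, ∃ ℓ, ℓ₀ ≤ ℓ ∧ ∀ w ∈ Y ∩ cylinder y ℓ, ∀ m, ℓ ≤ m →
      futureStates δ Y w m = futureStates δ Y y ℓ := by
  obtain ⟨M, hM⟩ := (Set.toFinite {M : Set (Q × Q) | ∃ y ∈ Y ∩ cylinder z ℓ₀, ∃ ℓ, ℓ₀ ≤ ℓ ∧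
    futureStates δ Y y ℓ = M}).exists_minimal
      ⟨_, z, ⟨hz, self_mem_cylinder _ _⟩, ℓ₀, le_rfl, rfl⟩
  obtain ⟨⟨y, hy, ℓ, hℓ, rfl⟩, hmin⟩ := hM
  refine ⟨y, hy, ℓ, hℓ, fun w hw m hm => ?_⟩
  have h := futureStates_anti δ Y hw.2 hm
  exact le_antisymm h
    (hmin ⟨w, ⟨hw.1, mem_cylinder_trans hw.2 hy.2 hℓ⟩, m, hℓ.trans hm, rfl⟩ h)

/-- Take a maximal window set. By stability any future pair is still realised by an extension of
`w`, and the window of that extension contains the old one, so the pair was already there. -/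
theorem exists_saturated_word [Finite Q] (δ : Q → S → Q) (Y : Set (ℕ → S)) {y : ℕ → S}
    (hy : y ∈ Y) {ℓ : ℕ} (hs : ∀ w ∈ Y ∩ cylinder y ℓ, ∀ m, ℓ ≤ m →
      futureStates δ Y w m = futureStates δ Y y ℓ) :
    ∃ w ∈ Y ∩ cylinder y ℓ, ∃ m, ℓ ≤ m ∧ futureStates δ Y y ℓ ⊆ windowStates δ w ℓ m := by
  obtain ⟨V, hV⟩ := (Set.toFinite {V : Set (Q × Q) | ∃ w ∈ Y ∩ cylinder y ℓ, ∃ m, ℓ ≤ m ∧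
    windowStates δ w ℓ m = V}).exists_maximal
      ⟨_, y, ⟨hy, self_mem_cylinder _ _⟩, ℓ, le_rfl, rfl⟩
  obtain ⟨⟨w, hw, m, hm, rfl⟩, hmax⟩ := hV
  refine ⟨w, hw, m, hm, fun pf hpf => ?_⟩
  rw [← hs w hw m hm] at hpf
  obtain ⟨v, ⟨hv, hvw⟩, i, hi, e⟩ := hpf
  refine hmax ⟨v, ⟨hv, mem_cylinder_trans hvw hw.2 hm⟩, i, hm.trans hi, rfl⟩ ?_
    ⟨i, hm.trans hi, le_rfl, e⟩
  rintro pf ⟨j, hj, hjm, e⟩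
  exact ⟨j, hj, hjm.trans hi, by rw [runFrom_congr δ _ hvw hjm, e]⟩

/-- The run from `q` on `z` stays in a set of states from time `N` on, and every later window of
length `N` meets all of its members. -/
def EventuallyWindowed (δ : Q → S → Q) (N : ℕ) (q : Q) (z : ℕ → S) : Prop :=
  ∃ F : Set Q, (∀ i, N ≤ i → runFrom δ q z i ∈ F) ∧
    ∀ f ∈ F, ∀ i, N ≤ i → ∃ j, i ≤ j ∧ j < i + N ∧ runFrom δ q z j = f

theorem EventuallyWindowed.mono {δ : Q → S → Q} {N M : ℕ} {q : Q} {z : ℕ → S}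
    (h : EventuallyWindowed δ N q z) (hNM : N ≤ M) : EventuallyWindowed δ M q z := by
  obtain ⟨F, h1, h2⟩ := h
  refine ⟨F, fun i hi => h1 i (hNM.trans hi), fun f hf i hi => ?_⟩
  obtain ⟨j, hj, hj', e⟩ := h2 f hf i (hNM.trans hi)
  exact ⟨j, hj, by omega, e⟩

theorem exists_eventuallyWindowed_nhds [Finite Q] (δ : Q → S → Q) {Y : Set (ℕ → S)}
    (hmaps : MapsTo shift Y Y) (hU : BoundedReturns Y) (hD : LocallyApproached Y)
    {z₀ : ℕ → S} (hz₀ : z₀ ∈ Y) :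
    ∃ ℓ N, ∀ z ∈ Y ∩ cylinder z₀ ℓ, ∀ q, EventuallyWindowed δ N q z := by
  obtain ⟨ℓ₀, hℓ₀⟩ := hD z₀ hz₀
  obtain ⟨y, hy, ℓ, hℓ, hs⟩ := exists_stable_word δ Y hz₀ ℓ₀
  obtain ⟨w, hw, m, hm, hV⟩ := exists_saturated_word δ Y hy.1 hs
  obtain ⟨n, hn⟩ := hU w hw.1 m
  -- The word of `w` occurs in `z₀` itself: `w` follows `z₀` for `n + m` letters from time `j₀` on,
  -- and its first `m` letters return within `n` steps after `j₀`.
  obtain ⟨d, hd⟩ : ∃ d, shift^[d] z₀ ∈ cylinder w m := by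
    obtain ⟨j₀, hj₀⟩ := hℓ₀ w ⟨hw.1, mem_cylinder_trans hw.2 hy.2 hℓ⟩ (n + m)
    obtain ⟨j, hj, hj', h⟩ := hn w ⟨hw.1, self_mem_cylinder _ _⟩ j₀
    obtain ⟨d, rfl⟩ := Nat.exists_eq_add_of_le hj
    refine ⟨d, fun i hi => ?_⟩
    rw [← h i hi, iterate_shift_apply, iterate_shift_apply, ← hj₀ (i + d) (by omega),
      iterate_shift_apply]
    congr 1
    omega
  refine ⟨d + m, d + ℓ + n + m + 1, fun z hz q => ?_⟩
  have hz1 : shift^[d] z ∈ Y ∩ cylinder w m :=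
    ⟨hmaps.iterate d hz.1, mem_cylinder_trans (iterate_shift_mem_cylinder hz.2) hd le_rfl⟩
  have hz2 : shift^[d] z ∈ Y ∩ cylinder y ℓ := ⟨hz1.1, mem_cylinder_trans hz1.2 hw.2 hm⟩
  set z₁ := shift^[d] z with hz₁
  set p := runFrom δ q z d with hp
  refine ⟨{f | (p, f) ∈ futureStates δ Y y ℓ}, fun i hi => ?_, fun f hf i hi => ?_⟩
  · obtain ⟨i, rfl⟩ := Nat.exists_eq_add_of_le (show d ≤ i by omega)
    exact ⟨z₁, hz2, i, by omega, (runFrom_add δ q z d i).symm⟩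
  · obtain ⟨j, hj, hj', h⟩ := hn z₁ hz1 (i - d)
    have hf' : (p, f) ∈ futureStates δ Y y ℓ := hf
    rw [← hs z₁ hz2 (j + ℓ) (by omega)] at hf'
    obtain ⟨w₂, ⟨hw₂, hw₂z⟩, i₂, hi₂, e⟩ := hf'
    obtain ⟨i₃, rfl⟩ := Nat.exists_eq_add_of_le (show j ≤ i₂ by omega)
    -- Stability keeps `f` reachable after the return at time `j`; cutting off `j` letters makes it
    -- a future state of the current state, so saturation of `w` shows it within `m` further steps.
    have key : (runFrom δ p z₁ j, f) ∈ futureStates δ Y y ℓ := by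
      refine ⟨shift^[j] w₂, ⟨hmaps.iterate j hw₂, ?_⟩, i₃, by omega, ?_⟩
      · exact mem_cylinder_trans (iterate_shift_mem_cylinder hw₂z)
          (mem_cylinder_trans h hw.2 hm) le_rfl
      · rw [← e, runFrom_add, runFrom_congr δ p hw₂z (show j ≤ j + ℓ by omega)]
    obtain ⟨i₄, hi₄, hi₄', e₄⟩ := hV key
    refine ⟨d + (j + i₄), by omega, by omega, ?_⟩
    rw [runFrom_add, runFrom_add, ← hp, ← hz₁, runFrom_congr δ _ h hi₄']
    exact e₄

/-! ### Orbit closures and recurrence in quasiminimal subshifts. -/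

variable [TopologicalSpace S]

theorem continuous_shift : Continuous (shift : (ℕ → S) → ℕ → S) :=
  continuous_pi fun i => continuous_apply (i + 1)

/-- The closure of the forward orbit of `x`. -/
def orbitClosure (x : ℕ → S) : Set (ℕ → S) := closure (range fun n => shift^[n] x)

theorem isSubshift_orbitClosure (x : ℕ → S) : IsSubshift (orbitClosure x) := by
  refine ⟨isClosed_closure, MapsTo.closure ?_ continuous_shift⟩
  rintro _ ⟨n, rfl⟩
  exact ⟨n + 1, Function.iterate_succ_apply' _ _ _⟩

theorem mem_orbitClosure_self (x : ℕ → S) : x ∈ orbitClosure x := subset_closure ⟨0, rfl⟩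

theorem orbitClosure_subset {x : ℕ → S} {Y : Set (ℕ → S)} (hY : IsSubshift Y) (hx : x ∈ Y) :
    orbitClosure x ⊆ Y := by
  refine closure_minimal ?_ hY.1
  rintro _ ⟨n, rfl⟩
  exact hY.2.iterate n hx

theorem finite_subshifts {X : Set (ℕ → S)} (hq : IsQuasiminimal X) :
    {Y : Set (ℕ → S) | IsSubshift Y ∧ Y ⊆ X}.Finite := by
  refine (Set.Finite.insert X hq).subset ?_
  rintro Y ⟨h, hY⟩
  rcases hY.eq_or_ssubset with rfl | h'
  · exact mem_insert _ _
  · exact mem_insert_of_mem _ ⟨h, h'⟩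

variable [DiscreteTopology S]

theorem exists_eventuallyWindowed [Finite Q] (δ : Q → S → Q) {Y : Set (ℕ → S)}
    (hY : IsCompact Y) (hmaps : MapsTo shift Y Y) (hU : BoundedReturns Y)
    (hD : LocallyApproached Y) : ∃ N, ∀ z ∈ Y, ∀ q, EventuallyWindowed δ N q z := by
  refine hY.induction_on (p := fun s => ∃ N, ∀ z ∈ s, ∀ q, EventuallyWindowed δ N q z)
    ⟨0, by simp⟩ (fun s t hst ⟨N, h⟩ => ⟨N, fun z hz => h z (hst hz)⟩) ?_ ?_
  · rintro s t ⟨N, h⟩ ⟨M, h'⟩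
    refine ⟨max N M, fun z hz q => ?_⟩
    rcases hz with hz | hz
    · exact (h z hz q).mono (le_max_left _ _)
    · exact (h' z hz q).mono (le_max_right _ _)
  · intro x hx
    obtain ⟨ℓ, N, h⟩ := exists_eventuallyWindowed_nhds δ hmaps hU hD hx
    exact ⟨Y ∩ cylinder x ℓ, Filter.inter_mem self_mem_nhdsWithin (mem_nhdsWithin_of_mem_nhds
      ((isOpen_cylinder (fun _ => S) x ℓ).mem_nhds (self_mem_cylinder _ _))), N, h⟩

theorem mem_closure_iff_cylinder {x : ℕ → S} {A : Set (ℕ → S)} :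
    x ∈ closure A ↔ ∀ ℓ, ∃ y ∈ A, y ∈ cylinder x ℓ := by
  constructor
  · intro h ℓ
    obtain ⟨y, hy, hA⟩ := mem_closure_iff.1 h _ (isOpen_cylinder (fun _ => S) x ℓ)
      (self_mem_cylinder _ _)
    exact ⟨y, hA, hy⟩
  · intro h
    rw [(isTopologicalBasis_cylinders (fun _ : ℕ => S)).mem_closure_iff]
    rintro _ ⟨u, n, rfl⟩ hx
    obtain ⟨y, hA, hy⟩ := h n
    exact ⟨y, mem_cylinder_trans hy hx le_rfl, hA⟩

theorem mem_orbitClosure_iff {x y : ℕ → S} :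
    x ∈ orbitClosure y ↔ ∀ ℓ, ∃ j, shift^[j] y ∈ cylinder x ℓ := by
  rw [orbitClosure, mem_closure_iff_cylinder]
  simp

/-- The subshifts of `Y` that miss `x` are finitely many, so their union is closed and some cylinder
around `x` avoids it. The orbit closure of a point in that cylinder cannot miss `x`. -/
theorem locallyApproached {Y : Set (ℕ → S)}
    (hfin : {Z : Set (ℕ → S) | IsSubshift Z ∧ Z ⊆ Y}.Finite) (hY : IsSubshift Y) :
    LocallyApproached Y := by
  intro x hx
  set B := {Z : Set (ℕ → S) | (IsSubshift Z ∧ Z ⊆ Y) ∧ x ∉ Z} with hB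
  have hclosed : IsClosed (⋃ Z ∈ B, Z) :=
    (hfin.subset fun Z hZ => hZ.1).isClosed_biUnion fun Z hZ => hZ.1.1.1
  have hxB : x ∉ ⋃ Z ∈ B, Z := by
    simp only [mem_iUnion, not_exists]
    exact fun Z hZ => hZ.2
  rw [← hclosed.closure_eq, mem_closure_iff_cylinder] at hxB
  push Not at hxB
  obtain ⟨ℓ, hℓ⟩ := hxB
  refine ⟨ℓ, fun y hy => mem_orbitClosure_iff.1 ?_⟩
  by_contra hxy
  exact hℓ y (mem_biUnion (show orbitClosure y ∈ B from ⟨⟨isSubshift_orbitClosure y,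
    orbitClosure_subset hY hy.1⟩, hxy⟩) (mem_orbitClosure_self y)) hy.2

theorem exists_eq_succ_of_antitone {α : Type*} [PartialOrder α] {f : ℕ → α} (hf : Antitone f)
    (hfin : (range f).Finite) : ∃ k, f (k + 1) = f k := by
  by_contra! h
  exact (infinite_range_of_injective (strictAnti_nat_of_succ_lt fun n =>
    lt_of_le_of_ne (hf n.le_succ) (h n)).injective) hfin

/-- Along a backward orbit of `x` the orbit closures increase, so two consecutive ones coincide.
Pushing this recurrence forward by the shift brings it to `x`. -/
theorem mem_orbitClosure_shift {Y : Set (ℕ → S)}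
    (hfin : {Z : Set (ℕ → S) | IsSubshift Z ∧ Z ⊆ Y}.Finite) (hY : IsSubshift Y)
    (hsurj : SurjOn shift Y Y) {x : ℕ → S} (hx : x ∈ Y) : x ∈ orbitClosure (shift x) := by
  choose! g hg hσ using hsurj
  have hmem : ∀ n, g^[n] x ∈ Y := fun n => MapsTo.iterate (fun _ h => hg h) n hx
  have hstep : ∀ n, shift (g^[n + 1] x) = g^[n] x := fun n => by
    rw [Function.iterate_succ_apply', hσ (hmem n)]
  have hit : ∀ n, shift^[n] (g^[n] x) = x := fun n => by
    induction n with
    | zero => rfl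
    | succ n ih => rw [Function.iterate_succ_apply, hstep, ih]
  have hmono : Monotone fun n => orbitClosure (g^[n] x) := monotone_nat_of_le_succ fun n => by
    refine orbitClosure_subset (isSubshift_orbitClosure _) ?_
    rw [← hstep n]
    exact (isSubshift_orbitClosure _).2 (mem_orbitClosure_self _)
  obtain ⟨k, hk⟩ := exists_eq_succ_of_antitone (α := (Set (ℕ → S))ᵒᵈ) hmono.dual_right
    (hfin.subset (by
      rintro _ ⟨n, rfl⟩
      exact ⟨isSubshift_orbitClosure _, orbitClosure_subset hY (hmem n)⟩))
  have h : g^[k + 1] x ∈ orbitClosure (g^[k] x) := by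
    have hk' : orbitClosure (g^[k + 1] x) = orbitClosure (g^[k] x) := hk
    rw [← hk']
    exact mem_orbitClosure_self _
  rw [mem_orbitClosure_iff] at h ⊢
  intro ℓ
  -- The shift by `k + 1` that takes `g^[k + 1] x` to `x` uses up `k + 1` letters of agreement.
  obtain ⟨j, hj⟩ := h (k + 1 + ℓ)
  refine ⟨j, ?_⟩
  have := iterate_shift_mem_cylinder hj
  rwa [hit, ← Function.iterate_add_apply, ← hstep k, ← Function.iterate_succ_apply,
    show (k + 1 + j).succ = (j + 1) + (k + 1) by omega, Function.iterate_add_apply, hit,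
    Function.iterate_succ_apply] at this

theorem boundedReturns {Y : Set (ℕ → S)} (hc : IsCompact Y) (hmaps : MapsTo shift Y Y)
    (hrec : ∀ x ∈ Y, x ∈ orbitClosure (shift x)) : BoundedReturns Y := by
  intro x hx ℓ
  obtain ⟨n, hn⟩ : ∃ n, ∀ z ∈ Y ∩ cylinder x ℓ, ∃ j, 1 ≤ j ∧ j ≤ n ∧
      shift^[j] z ∈ cylinder x ℓ := by
    refine hc.induction_on (p := fun s => ∃ n, ∀ z ∈ s ∩ cylinder x ℓ, ∃ j, 1 ≤ j ∧ j ≤ n ∧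
      shift^[j] z ∈ cylinder x ℓ) ⟨0, by simp⟩
      (fun s t hst ⟨N, h⟩ => ⟨N, fun z hz => h z ⟨hst hz.1, hz.2⟩⟩) ?_ ?_
    · rintro s t ⟨N, h⟩ ⟨M, h'⟩
      refine ⟨max N M, fun z ⟨hz, hzx⟩ => ?_⟩
      rcases hz with hz | hz
      · obtain ⟨j, h1, h2, h3⟩ := h z ⟨hz, hzx⟩
        exact ⟨j, h1, le_max_of_le_left h2, h3⟩
      · obtain ⟨j, h1, h2, h3⟩ := h' z ⟨hz, hzx⟩
        exact ⟨j, h1, le_max_of_le_right h2, h3⟩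
    · intro y hy
      obtain ⟨j, hj⟩ := mem_orbitClosure_iff.1 (hrec y hy) ℓ
      rw [← Function.iterate_succ_apply] at hj
      refine ⟨cylinder y (j + 1 + ℓ), mem_nhdsWithin_of_mem_nhds
        ((isOpen_cylinder (fun _ => S) y _).mem_nhds (self_mem_cylinder _ _)), j + 1,
        fun z ⟨hz, hzx⟩ => ⟨j + 1, by omega, le_rfl, ?_⟩⟩
      have hyx : y ∈ cylinder x ℓ := fun i hi => by rw [← hz i (by omega), hzx i hi]
      exact mem_cylinder_trans (iterate_shift_mem_cylinder hz)
        (mem_cylinder_trans hj hyx le_rfl) le_rfl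
  -- A return at time exactly `i` is replaced by the next one, at most `n` later; any other return
  -- at or after `i` also serves `i + 1`.
  refine ⟨n, fun z hz i => ?_⟩
  induction i with
  | zero => exact ⟨0, le_rfl, by omega, hz.2⟩
  | succ i ih =>
    obtain ⟨j, hj, hj', h⟩ := ih
    rcases hj.eq_or_lt with rfl | hlt
    · obtain ⟨j', h1, h2, h3⟩ := hn _ ⟨hmaps.iterate i hz.1, h⟩
      rw [← Function.iterate_add_apply] at h3
      exact ⟨j' + i, by omega, by omega, h3⟩
    · exact ⟨j, hlt, by omega, h⟩

theorem exists_iterate_shift_windowed [Finite S] {X : Set (ℕ → S)} (hX : IsSubshift X)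
    (hq : IsQuasiminimal X) : ∃ k, ∀ {Q : Type} [Finite Q] (δ : Q → S → Q),
      ∃ N, ∀ x ∈ X, ∀ q, EventuallyWindowed δ N q (shift^[k] x) := by
  have hfin := finite_subshifts hq
  have hsub : ∀ k, IsSubshift (shift^[k] '' X) ∧ shift^[k] '' X ⊆ X := fun k => by
    refine ⟨⟨(hX.1.isCompact.image (continuous_shift.iterate k)).isClosed, ?_⟩,
      (hX.2.iterate k).image_subset⟩
    rintro _ ⟨x, hx, rfl⟩
    exact ⟨shift x, hX.2 hx, (Function.Commute.iterate_self shift k x)⟩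
  obtain ⟨k, hk⟩ := exists_eq_succ_of_antitone (f := fun k => shift^[k] '' X)
    (antitone_nat_of_succ_le fun k => by
      rintro _ ⟨x, hx, rfl⟩
      exact ⟨shift x, hX.2 hx, rfl⟩)
    (hfin.subset (by rintro _ ⟨k, rfl⟩; exact hsub k))
  set Y := shift^[k] '' X with hY
  have hfinY : {Z : Set (ℕ → S) | IsSubshift Z ∧ Z ⊆ Y}.Finite :=
    hfin.subset fun Z hZ => ⟨hZ.1, hZ.2.trans (hsub k).2⟩
  have hsurj : SurjOn shift Y Y := by
    intro y hy
    have hy' : y ∈ shift^[k + 1] '' X := hk ▸ hy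
    obtain ⟨x, hx, rfl⟩ := hy'
    exact ⟨shift^[k] x, ⟨x, hx, rfl⟩, (Function.iterate_succ_apply' _ _ _).symm⟩
  have hYs : IsSubshift Y := (hsub k).1
  refine ⟨k, fun δ => ?_⟩
  obtain ⟨N, hN⟩ := exists_eventuallyWindowed δ hYs.1.isCompact hYs.2
    (boundedReturns hYs.1.isCompact hYs.2 fun x hx => mem_orbitClosure_shift hfinY hYs hsurj hx)
    (locallyApproached hfinY hYs)
  exact ⟨N, fun x hx => hN _ ⟨x, hx, rfl⟩⟩

end Dynamics

/-! ### Closure of decidable predicates under bounded quantifiers and search. -/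

section Computability

variable {α β : Type*}

/-- Whether `p` holds at the first `n` entries of `l`. -/
def checkFirst (p : β → Bool) (l : List β) (n : ℕ) : Bool :=
  Nat.rec true (fun i acc => acc && ((l[i]?).map p).getD true) n

theorem checkFirst_length (p : β → Bool) (l : List β) :
    checkFirst p l l.length = true ↔ ∀ b ∈ l, p b = true := by
  have key : ∀ n, checkFirst p l n = true ↔ ∀ i < n, ∀ b, l[i]? = some b → p b = true := by
    intro n
    induction n with
    | zero => simp [checkFirst]
    | succ n ih =>
      have : checkFirst p l (n + 1) = (checkFirst p l n && ((l[n]?).map p).getD true) := rfl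
      rw [this, Bool.and_eq_true, ih]
      simp only [Nat.lt_succ_iff_lt_or_eq, or_imp, forall_and, forall_eq]
      refine and_congr_right fun _ => ?_
      cases l[n]? <;> simp
  rw [key]
  constructor
  · intro h b hb
    obtain ⟨i, hi, rfl⟩ := List.mem_iff_getElem.1 hb
    exact h i hi _ (List.getElem?_eq_getElem hi)
  · exact fun h i _ b hb => h b (List.mem_of_getElem? hb)

variable [Primcodable α] [Primcodable β]

theorem _root_.ComputablePred.comp {p : β → Prop} (hp : ComputablePred p) {f : α → β}
    (hf : Computable f) : ComputablePred fun a => p (f a) := by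
  obtain ⟨_, hp⟩ := hp
  exact ⟨fun a => inferInstance, hp.comp hf⟩

theorem _root_.ComputablePred.and {p q : α → Prop} (hp : ComputablePred p)
    (hq : ComputablePred q) : ComputablePred fun a => p a ∧ q a := by
  obtain ⟨_, hp⟩ := hp
  obtain ⟨_, hq⟩ := hq
  exact ⟨fun a => inferInstance, (Primrec.and.to_comp.comp hp hq).of_eq fun a => by simp⟩

theorem computable_checkFirst {p : α → β → Bool} (hp : Computable₂ p) {f : α → List β}
    (hf : Computable f) : Computable fun a => checkFirst (p a) (f a) (f a).length := by
  have hget : Computable fun t : α × ℕ × Bool => (f t.1)[t.2.1]? :=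
    Computable.list_getElem?.comp (hf.comp Computable.fst) (Computable.fst.comp Computable.snd)
  have hpt : Computable₂ fun (t : α × ℕ × Bool) (b : β) => p t.1 b :=
    hp.comp (Computable.fst.comp Computable.fst) Computable.snd
  have hstep : Computable₂ fun (a : α) (t : ℕ × Bool) =>
      t.2 && (((f a)[t.1]?).map (p a)).getD true := Primrec.and.to_comp.comp
    (Computable.snd.comp Computable.snd)
    ((Computable.option_map hget hpt).option_getD (Computable.const true))
  exact Computable.nat_rec (Computable.list_length.comp hf) (Computable.const true) hstep

theorem _root_.ComputablePred.forall_mem_list {p : α → β → Prop}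
    (hp : ComputablePred fun t : α × β => p t.1 t.2) {f : α → List β} (hf : Computable f) :
    ComputablePred fun a => ∀ b ∈ f a, p a b := by
  classical
  have hp' : Computable₂ fun a b => decide (p a b) := hp.decide
  refine ⟨fun a => Classical.dec _, (computable_checkFirst hp' hf).of_eq fun a => ?_⟩
  rw [Bool.eq_iff_iff, checkFirst_length]
  simp

theorem _root_.ComputablePred.exists_mem_list {p : α → β → Prop}
    (hp : ComputablePred fun t : α × β => p t.1 t.2) {f : α → List β} (hf : Computable f) :
    ComputablePred fun a => ∃ b ∈ f a, p a b :=
  (ComputablePred.forall_mem_list (p := fun a b => ¬ p a b) hp.not hf).not.of_eq fun a => by simp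

/-- A predicate that can be evaluated at any parameter found by an unbounded search is decidable. -/
theorem _root_.ComputablePred.of_search {C D : α → ℕ → Prop}
    (hC : ComputablePred fun t : α × ℕ => C t.1 t.2)
    (hD : ComputablePred fun t : α × ℕ => D t.1 t.2) (h : ∀ a, ∃ n, C a n) :
    ∃ P : α → Prop, ComputablePred P ∧ ∀ a, ∃ n, C a n ∧ (P a ↔ D a n) := by
  classical
  have hC' : Computable₂ fun a n => decide (C a n) := hC.decide
  have hf : Computable fun a => Nat.find (h a) := by
    refine (Partrec.rfind hC'.partrec₂).of_eq_tot fun a => ?_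
    refine Nat.mem_rfind.2 ⟨by simpa using Nat.find_spec (h a), fun hm => ?_⟩
    simpa using Nat.find_min (h a) hm
  exact ⟨fun a => D a (Nat.find (h a)), hD.comp (Computable.id.pair hf),
    fun a => ⟨_, Nat.find_spec (h a), Iff.rfl⟩⟩

end Computability

/-! ### Words of the language as prefixes of points. -/

section Words

variable {S : Type*}

/-- The word formed by the first `n` letters of `x`. -/
def initialWord (x : ℕ → S) (n : ℕ) : List S := (List.range n).map x

theorem length_initialWord (x : ℕ → S) (n : ℕ) : (initialWord x n).length = n := by
  simp [initialWord]

theorem initialWord_mem_language {X : Set (ℕ → S)} {x : ℕ → S} (hx : x ∈ X) (n : ℕ) :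
    initialWord x n ∈ language X := by
  refine ⟨x, hx, 0, ?_⟩
  rw [length_initialWord]
  simp [initialWord]

theorem exists_initialWord_of_mem_language {X : Set (ℕ → S)} (hX : MapsTo shift X X)
    {w : List S} (hw : w ∈ language X) : ∃ x ∈ X, initialWord x w.length = w := by
  obtain ⟨x, hx, i, hi⟩ := hw
  refine ⟨shift^[i] x, hX.iterate i hx, ?_⟩
  conv_rhs => rw [← hi]
  exact List.map_congr_left fun j _ => by rw [iterate_shift_apply, add_comm]

theorem take_initialWord (x : ℕ → S) {m n : ℕ} (h : m ≤ n) :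
    (initialWord x n).take m = initialWord x m := by
  rw [initialWord, ← List.map_take, List.take_range, min_eq_left h, initialWord]

theorem drop_initialWord (x : ℕ → S) (m n : ℕ) :
    (initialWord x (m + n)).drop m = initialWord (shift^[m] x) n := by
  rw [initialWord, List.range_add, List.map_append, List.drop_left' (by simp), initialWord,
    List.map_map]
  refine List.map_congr_left fun i _ => ?_
  rw [iterate_shift_apply, Function.comp_apply, add_comm]

/-- All words of length `n` over the given letters. -/
def wordsOfLength (letters : List S) : ℕ → List (List S)
  | 0 => [[]]
  | n + 1 => (wordsOfLength letters n).flatMap fun w => letters.map fun a => a :: w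

theorem mem_wordsOfLength {letters : List S} (h : ∀ a, a ∈ letters) {n : ℕ} {w : List S} :
    w ∈ wordsOfLength letters n ↔ w.length = n := by
  induction n generalizing w with
  | zero => simp [wordsOfLength]
  | succ n ih =>
    cases w with
    | nil => simp [wordsOfLength]
    | cons a w => simp [wordsOfLength, ih, h]

theorem primrec_wordsOfLength [Primcodable S] (letters : List S) :
    Primrec (wordsOfLength letters) := by
  refine (Primrec.nat_rec₁ [[]] (f := fun _ W => W.flatMap fun w => letters.map fun a => a :: w)
    ?_).of_eq fun n => ?_
  · refine Primrec.list_flatMap Primrec.snd (Primrec.list_map (Primrec.const letters) ?_)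
    exact Primrec.list_cons.comp Primrec.snd (Primrec.snd.comp Primrec.fst)
  · induction n with
    | zero => rfl
    | succ n ih => rw [wordsOfLength, ← ih]

/-! ### Simulating coded automata and certifying a window length. -/

variable [DecidableEq S]

/-- The transition function read off from a description; missing entries lead to the state `0`. -/
def codeStep (c : MullerCode S) (q : ℕ) (a : S) : ℕ :=
  (c.2.2.1.lookup (q, a)).getD 0

/-- A list of states, containing the initial one, to which `codeStep` is confined. -/
def codeStates (c : MullerCode S) : List ℕ := c.2.1 :: 0 :: c.2.2.1.map Prod.snd

/-- The state reached from `q` after the first `i` letters of `w`. -/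
def codeState (c : MullerCode S) (q : ℕ) (w : List S) (i : ℕ) : ℕ :=
  (w.take i).foldl (codeStep c) q

theorem codeState_initialWord (c : MullerCode S) (q : ℕ) (x : ℕ → S) {i n : ℕ} (h : i ≤ n) :
    codeState c q (initialWord x n) i = runFrom (codeStep c) q x i := by
  rw [codeState, take_initialWord x h]
  clear h
  induction i with
  | zero => rfl
  | succ i ih =>
    rw [runFrom, ← ih, initialWord, List.range_succ, List.map_append, List.foldl_append]
    rfl

theorem codeStep_mem_codeStates (c : MullerCode S) (q : ℕ) (a : S) :
    codeStep c q a ∈ codeStates c := by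
  rw [codeStep, codeStates]
  cases h : c.2.2.1.lookup (q, a) with
  | none => simp
  | some r =>
    obtain ⟨l₁, l₂, h, -⟩ := List.lookup_eq_some_iff.1 h
    simp [h]

theorem runFrom_mem_codeStates (c : MullerCode S) {q : ℕ} (hq : q ∈ codeStates c) (x : ℕ → S)
    (i : ℕ) : runFrom (codeStep c) q x i ∈ codeStates c := by
  cases i with
  | zero => exact hq
  | succ i => exact codeStep_mem_codeStates c _ _

/-- Repeated entries are harmless: whichever one the lookup finds is a true transition. -/
theorem codeStep_of_isDescribedBy {A : MullerAutomaton S} {c : MullerCode S}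
    (h : A.IsDescribedBy c) (p : Fin A.numStates) (a : S) : codeStep c p a = A.step p a := by
  rw [codeStep]
  have hmem : (((p : ℕ), a), (A.step p a : ℕ)) ∈ c.2.2.1 := (h.2.2.1 _).2 ⟨p, a, rfl⟩
  cases h' : c.2.2.1.lookup ((p : ℕ), a) with
  | none => exact absurd (List.lookup_eq_none_iff.1 h' _ hmem) (by simp)
  | some r =>
    obtain ⟨l₁, l₂, e, -⟩ := List.lookup_eq_some_iff.1 h'
    obtain ⟨p', a', e'⟩ := (h.2.2.1 (((p : ℕ), a), r)).1 (by simp [e])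
    simp only [Prod.mk.injEq] at e'
    obtain ⟨⟨hp, rfl⟩, rfl⟩ := e'
    rw [Fin.ext hp]
    rfl

theorem runFrom_codeStep_of_isDescribedBy {A : MullerAutomaton S} {c : MullerCode S}
    (h : A.IsDescribedBy c) (x : ℕ → S) (i : ℕ) :
    runFrom (codeStep c) c.2.1 x i = A.run x i := by
  induction i with
  | zero => exact h.2.1
  | succ i ih => rw [runFrom, ih, codeStep_of_isDescribedBy h]; rfl

/-- Acceptance in terms of a description. -/
def CodeAccepts (c : MullerCode S) (x : ℕ → S) : Prop :=
  ∃ l ∈ c.2.2.2, ∀ s : ℕ, s ∈ l ↔ {i | runFrom (codeStep c) c.2.1 x i = s}.Infinite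

theorem codeAccepts_iff {A : MullerAutomaton S} {c : MullerCode S} (h : A.IsDescribedBy c)
    (x : ℕ → S) : CodeAccepts c x ↔ A.Accepts x := by
  have hrun : ∀ q : Fin A.numStates, {i | runFrom (codeStep c) c.2.1 x i = q} =
      {i | A.run x i = q} := fun q => by
    ext i
    simp only [mem_ofPred_eq, runFrom_codeStep_of_isDescribedBy h, Fin.ext_iff]
  constructor
  · rintro ⟨l, hl, hs⟩
    refine ⟨Finset.univ.filter fun q : Fin A.numStates => (q : ℕ) ∈ l,
      (h.2.2.2.2 _).2 ⟨l, hl, by simp⟩, fun q => ?_⟩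
    rw [← hrun, ← hs]
    simp
  · rintro ⟨F, hF, hs⟩
    obtain ⟨l, hl, hFl⟩ := (h.2.2.2.2 F).1 hF
    refine ⟨l, hl, fun s => ?_⟩
    by_cases hsA : s < A.numStates
    · rw [hrun ⟨s, hsA⟩, ← hs, hFl]
    · refine iff_of_false (fun hsl => hsA (h.2.2.2.1 l hl s hsl)) fun hinf => ?_
      obtain ⟨i, hi⟩ := hinf.nonempty
      rw [mem_ofPred_eq, runFrom_codeStep_of_isDescribedBy h] at hi
      exact hsA (hi ▸ (A.run x i).isLt)

/-- Reading `w` from `q`, the state at time `n` recurs within the next `n` steps, and the state at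
time `2 * n` occurs within the preceding `n` steps. -/
def WindowsAgree (c : MullerCode S) (n : ℕ) (w : List S) (q : ℕ) : Prop :=
  (∃ j ∈ List.range n, codeState c q w (n + 1 + j) = codeState c q w n) ∧
    ∃ j ∈ List.range n, codeState c q w (n + j) = codeState c q w (2 * n)

/-- The states at the times `m, …, m + n - 1` on reading `w` form a member of the table. -/
def WindowInTable (c : MullerCode S) (m n : ℕ) (w : List S) : Prop :=
  ∃ l ∈ c.2.2.2, (∀ s ∈ l, ∃ j ∈ List.range n, codeState c c.2.1 w (m + j) = s) ∧
    ∀ j ∈ List.range n, ∃ s ∈ l, codeState c c.2.1 w (m + j) = s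

/-- The test slides along `x`: since `X` is shift-invariant and all states of `codeStates` are
tested, it applies at every time `i`. Its first half pushes a visit forward indefinitely; its second
pulls any late visit back into the window starting at `k + n`. -/
theorem infinite_setOf_runFrom_iff {c : MullerCode S} {X : Set (ℕ → S)} (hX : MapsTo shift X X)
    {k n : ℕ} (hn : ∀ w ∈ language X, w.length = k + 2 * n → ∀ q ∈ codeStates c,
      WindowsAgree c n (w.drop k) q) {x : ℕ → S} (hx : x ∈ X) {q : ℕ} (hq : q ∈ codeStates c)
    (s : ℕ) : {i | runFrom (codeStep c) q x i = s}.Infinite ↔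
      ∃ j < n, runFrom (codeStep c) q x (k + n + j) = s := by
  set r := runFrom (codeStep c) q x with hr
  have hW : ∀ i, (∃ j < n, r (k + i + n + 1 + j) = r (k + i + n)) ∧
      ∃ j < n, r (k + i + n + j) = r (k + i + 2 * n) := by
    intro i
    have h := hn _ (initialWord_mem_language (hX.iterate i hx) (k + 2 * n))
      (length_initialWord _ _) (r (k + i)) (runFrom_mem_codeStates c hq x _)
    rw [drop_initialWord, ← Function.iterate_add_apply] at h
    have e : ∀ j, j ≤ 2 * n → codeState c (r (k + i))
        (initialWord (shift^[k + i] x) (2 * n)) j = r (k + i + j) := fun j hj => by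
      rw [codeState_initialWord _ _ _ hj, hr, runFrom_add _ _ _ (k + i) j]
    obtain ⟨⟨j, hj, h1⟩, j', hj', h2⟩ := h
    rw [List.mem_range] at hj hj'
    rw [e _ (by omega), e _ (by omega)] at h1 h2
    exact ⟨⟨j, hj, by simpa only [add_assoc] using h1⟩, j', hj',
      by simpa only [add_assoc] using h2⟩
  constructor
  · intro hinf
    have hback : ∀ i, ∃ j < n, r (k + n + j) = r (k + n + i) := by
      intro i
      induction i using Nat.strong_induction_on with
      | _ i ih =>
        by_cases hi : i < n
        · exact ⟨i, hi, rfl⟩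
        · obtain ⟨i, rfl⟩ := Nat.exists_eq_add_of_le (not_lt.1 hi)
          obtain ⟨j, hj, h⟩ := (hW i).2
          obtain ⟨j', hj', h'⟩ := ih (i + j) (by omega)
          refine ⟨j', hj', h'.trans ?_⟩
          rw [show k + n + (i + j) = k + i + n + j by omega, h]
          congr 1
          omega
    obtain ⟨i, hi, hle⟩ := hinf.exists_gt (k + n)
    obtain ⟨i, rfl⟩ := Nat.exists_eq_add_of_lt hle
    obtain ⟨j, hj, h⟩ := hback (i + 1)
    exact ⟨j, hj, h.trans hi⟩
  · rintro ⟨j, -, hj⟩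
    have hfwd : ∀ m, ∃ i, m ≤ i ∧ r (k + n + i) = s := by
      intro m
      induction m with
      | zero => exact ⟨j, Nat.zero_le _, hj⟩
      | succ m ih =>
        obtain ⟨i, hi, h⟩ := ih
        obtain ⟨j', -, h'⟩ := (hW i).1
        refine ⟨i + 1 + j', by omega, ?_⟩
        rw [show k + n + (i + 1 + j') = k + i + n + 1 + j' by omega, h',
          show k + i + n = k + n + i by omega, h]
    refine Set.infinite_of_forall_exists_gt fun m => ?_
    obtain ⟨i, hi, h⟩ := hfwd (m + 1)
    exact ⟨k + n + i, h, by omega⟩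

theorem exists_codeAccepts_iff {c : MullerCode S} {X : Set (ℕ → S)} (hX : MapsTo shift X X)
    {k n : ℕ} (hn : ∀ w ∈ language X, w.length = k + 2 * n → ∀ q ∈ codeStates c,
      WindowsAgree c n (w.drop k) q) :
    (∃ x ∈ X, CodeAccepts c x) ↔
      ∃ w ∈ language X, w.length = k + 2 * n ∧ WindowInTable c (k + n) n w := by
  have key : ∀ x ∈ X, CodeAccepts c x ↔
      WindowInTable c (k + n) n (initialWord x (k + 2 * n)) := by
    intro x hx
    have e : ∀ j < n, codeState c c.2.1 (initialWord x (k + 2 * n)) (k + n + j) =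
        runFrom (codeStep c) c.2.1 x (k + n + j) := fun j hj =>
      codeState_initialWord _ _ _ (by omega)
    refine exists_congr fun l => and_congr_right fun _ => ?_
    simp only [infinite_setOf_runFrom_iff hX hn hx (show c.2.1 ∈ codeStates c by
      simp [codeStates]), List.mem_range]
    constructor
    · refine fun h => ⟨fun s hs => ?_, fun j hj => ⟨_, (h _).2 ⟨j, hj, rfl⟩, e j hj⟩⟩
      obtain ⟨j, hj, h⟩ := (h s).1 hs
      exact ⟨j, hj, (e j hj).trans h⟩
    · rintro ⟨h1, h2⟩ s
      constructor
      · intro hs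
        obtain ⟨j, hj, h⟩ := h1 s hs
        exact ⟨j, hj, (e j hj).symm.trans h⟩
      · rintro ⟨j, hj, rfl⟩
        obtain ⟨s, hs, h⟩ := h2 j hj
        rwa [← e j hj, h]
  constructor
  · rintro ⟨x, hx, h⟩
    exact ⟨_, initialWord_mem_language hx _, length_initialWord _ _, (key x hx).1 h⟩
  · rintro ⟨w, hw, hlen, h⟩
    obtain ⟨x, hx, e⟩ := exists_initialWord_of_mem_language hX hw
    rw [hlen] at e
    exact ⟨x, hx, (key x hx).2 (e ▸ h)⟩

theorem exists_windowsAgree {c : MullerCode S} {X : Set (ℕ → S)} (hX : MapsTo shift X X)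
    {k : ℕ} (hk : ∀ {Q : Type} [Finite Q] (δ : Q → S → Q),
      ∃ N, ∀ x ∈ X, ∀ q, EventuallyWindowed δ N q (shift^[k] x)) :
    ∃ n, ∀ w ∈ language X, w.length = k + 2 * n → ∀ q ∈ codeStates c,
      WindowsAgree c n (w.drop k) q := by
  -- Restricting to `codeStates c` gives a finite system even for a code describing no automaton, so
  -- the search terminates on every input.
  let δ : {q // q ∈ codeStates c} → S → {q // q ∈ codeStates c} :=
    fun q a => ⟨codeStep c q a, codeStep_mem_codeStates c q a⟩
  have hδ : ∀ q x i, (runFrom δ q x i).1 = runFrom (codeStep c) q x i := fun q x i => by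
    induction i with
    | zero => rfl
    | succ i ih => rw [runFrom, runFrom, ← ih]
  obtain ⟨N, hN⟩ := hk δ
  refine ⟨N + 1, fun w hw hlen q hq => ?_⟩
  obtain ⟨x, hx, e⟩ := exists_initialWord_of_mem_language hX hw
  rw [hlen] at e
  rw [← e, drop_initialWord]
  obtain ⟨F, h1, h2⟩ := hN x hx ⟨q, hq⟩
  have e' : ∀ j, j ≤ 2 * (N + 1) → codeState c q
      (initialWord (shift^[k] x) (2 * (N + 1))) j = (runFrom δ ⟨q, hq⟩ (shift^[k] x) j).1 :=
    fun j hj => by rw [codeState_initialWord _ _ _ hj, hδ]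
  constructor
  · obtain ⟨j, hj, hj', h⟩ := h2 _ (h1 (N + 1) (by omega)) (N + 1 + 1) (by omega)
    obtain ⟨j, rfl⟩ := Nat.exists_eq_add_of_le hj
    exact ⟨j, List.mem_range.2 (by omega), by rw [e' _ (by omega), e' _ (by omega), h]⟩
  · obtain ⟨j, hj, hj', h⟩ := h2 _ (h1 (2 * (N + 1)) (by omega)) (N + 1) (by omega)
    obtain ⟨j, rfl⟩ := Nat.exists_eq_add_of_le hj
    exact ⟨j, List.mem_range.2 (by omega), by rw [e' _ (by omega), e' _ (by omega), h]⟩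

end Words

/-! ### The decision procedure and its computability. -/

section Algorithm

variable {S : Type*} [Primcodable S]

theorem primrec_codeStates : Primrec (codeStates : MullerCode S → List ℕ) :=
  Primrec.list_cons.comp (Primrec.fst.comp Primrec.snd)
    (Primrec.list_cons.comp (Primrec.const 0)
      (Primrec.list_map (Primrec.fst.comp (Primrec.snd.comp Primrec.snd))
        (Primrec.snd.comp Primrec.snd)))

variable [DecidableEq S]

theorem primrec_codeStep {α : Type*} [Primcodable α] {c : α → MullerCode S} {q : α → ℕ}
    {s : α → S} (hc : Primrec c) (hq : Primrec q) (hs : Primrec s) :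
    Primrec fun t => codeStep (c t) (q t) (s t) := by
  have h1 : Primrec fun t => (c t).2.2.1 :=
    Primrec.fst.comp (Primrec.snd.comp (Primrec.snd.comp hc))
  have h2 := Primrec.option_getD.comp (Primrec.listLookup.comp (hq.pair hs) h1) (Primrec.const 0)
  refine h2.of_eq fun t => ?_
  -- The two lookups compare keys by different, but equal, `BEq` instances.
  have e : (instBEqOfDecidableEq : BEq (ℕ × S)) = instBEqProd := lawful_beq_subsingleton _ _
  rw [e]
  rfl

theorem primrec_codeState {α : Type*} [Primcodable α] {c : α → MullerCode S} {q i : α → ℕ}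
    {w : α → List S} (hc : Primrec c) (hq : Primrec q) (hw : Primrec w) (hi : Primrec i) :
    Primrec fun t => codeState (c t) (q t) (w t) (i t) := by
  have hstep : Primrec₂ fun (t : α) (b : ℕ × S) => codeStep (c t) b.1 b.2 :=
    primrec_codeStep (hc.comp Primrec.fst) (Primrec.fst.comp Primrec.snd)
      (Primrec.snd.comp Primrec.snd)
  exact Primrec.list_foldl (Primrec.list_take.comp hi hw) hq hstep

theorem computablePred_codeState_eq {α : Type*} [Primcodable α] {c : α → MullerCode S}
    {q i : α → ℕ} {w : α → List S} {s : α → ℕ} (hc : Primrec c) (hq : Primrec q) (hw : Primrec w)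
    (hi : Primrec i) (hs : Primrec s) :
    ComputablePred fun a => codeState (c a) (q a) (w a) (i a) = s a :=
  PrimrecPred.computablePred
    (Primrec.eq.comp (primrec_codeState hc hq hw hi) hs)

theorem computablePred_windowsAgree {α : Type*} [Primcodable α] {c : α → MullerCode S}
    {q n : α → ℕ} {w : α → List S} (hc : Primrec c) (hn : Primrec n) (hw : Primrec w)
    (hq : Primrec q) : ComputablePred fun a => WindowsAgree (c a) (n a) (w a) (q a) := by
  have hrange : Computable fun a => List.range (n a) := (Primrec.list_range.comp hn).to_comp
  have hst : ∀ {i : α → ℕ}, Primrec i → Primrec fun a => codeState (c a) (q a) (w a) (i a) :=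
    fun hi => primrec_codeState hc hq hw hi
  have f : Primrec fun t : α × ℕ => t.1 := Primrec.fst
  refine ComputablePred.and (ComputablePred.exists_mem_list ?_ hrange)
    (ComputablePred.exists_mem_list ?_ hrange)
  · exact computablePred_codeState_eq (hc.comp f) (hq.comp f) (hw.comp f)
      (Primrec.nat_add.comp (Primrec.succ.comp (hn.comp f)) Primrec.snd) ((hst hn).comp f)
  · exact computablePred_codeState_eq (hc.comp f) (hq.comp f) (hw.comp f)
      (Primrec.nat_add.comp (hn.comp f) Primrec.snd)
      ((hst (Primrec.nat_mul.comp (Primrec.const 2) hn)).comp f)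

theorem computablePred_windowInTable {α : Type*} [Primcodable α] {c : α → MullerCode S}
    {m n : α → ℕ} {w : α → List S} (hc : Primrec c) (hm : Primrec m) (hn : Primrec n)
    (hw : Primrec w) : ComputablePred fun a => WindowInTable (c a) (m a) (n a) (w a) := by
  have hq : Primrec fun a => (c a).2.1 := Primrec.fst.comp (Primrec.snd.comp hc)
  have htable : Primrec fun a => (c a).2.2.2 :=
    Primrec.snd.comp (Primrec.snd.comp (Primrec.snd.comp hc))
  have hrange : Primrec fun a => List.range (n a) := Primrec.list_range.comp hn
  refine ComputablePred.exists_mem_list ?_ htable.to_comp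
  refine ComputablePred.and ?_ ?_
  · refine ComputablePred.forall_mem_list ?_ Computable.snd
    refine ComputablePred.exists_mem_list ?_
      (hrange.comp (Primrec.fst.comp Primrec.fst)).to_comp
    have h : Primrec fun t : ((α × List ℕ) × ℕ) × ℕ => t.1.1.1 :=
      Primrec.fst.comp (Primrec.fst.comp Primrec.fst)
    exact computablePred_codeState_eq (hc.comp h) (hq.comp h) (hw.comp h)
      (Primrec.nat_add.comp (hm.comp h) Primrec.snd) (Primrec.snd.comp Primrec.fst)
  · refine ComputablePred.forall_mem_list ?_ (hrange.comp Primrec.fst).to_comp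
    refine ComputablePred.exists_mem_list ?_ (Computable.snd.comp Computable.fst)
    have h : Primrec fun t : ((α × List ℕ) × ℕ) × ℕ => t.1.1.1 :=
      Primrec.fst.comp (Primrec.fst.comp Primrec.fst)
    exact computablePred_codeState_eq (hc.comp h) (hq.comp h) (hw.comp h)
      (Primrec.nat_add.comp (hm.comp h) (Primrec.snd.comp Primrec.fst)) Primrec.snd

theorem isDecidable_of_windowed [Finite S] {X : Set (ℕ → S)} (hX : MapsTo shift X X)
    (hrec : IsRecursive X) {k : ℕ} (hk : ∀ {Q : Type} [Finite Q] (δ : Q → S → Q),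
      ∃ N, ∀ x ∈ X, ∀ q, EventuallyWindowed δ N q (shift^[k] x)) : IsDecidable X := by
  have := Fintype.ofFinite S
  let letters : List S := (Finset.univ : Finset S).toList
  have hletters : ∀ a, a ∈ letters := fun a => by simp [letters]
  have hwords : Primrec fun t : MullerCode S × ℕ => wordsOfLength letters (k + 2 * t.2) :=
    (primrec_wordsOfLength letters).comp (Primrec.nat_add.comp (Primrec.const k)
      (Primrec.nat_mul.comp (Primrec.const 2) Primrec.snd))
  have hlang : ComputablePred fun t : (MullerCode S × ℕ) × List S => t.2 ∈ language X :=
    ComputablePred.comp hrec Computable.snd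
  -- The implication is spelled with `∧` and `¬` to match the available closure properties.
  have hC : ComputablePred fun t : MullerCode S × ℕ =>
      ∀ w ∈ wordsOfLength letters (k + 2 * t.2), ¬ (w ∈ language X ∧
        ¬ ∀ q ∈ codeStates t.1, WindowsAgree t.1 t.2 (w.drop k) q) := by
    refine ComputablePred.forall_mem_list ?_ hwords.to_comp
    refine ComputablePred.not (ComputablePred.and hlang (ComputablePred.not ?_))
    refine ComputablePred.forall_mem_list ?_ ?_
    · have h : Primrec fun t : ((MullerCode S × ℕ) × List S) × ℕ => t.1.1 :=
        Primrec.fst.comp Primrec.fst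
      exact computablePred_windowsAgree (Primrec.fst.comp h) (Primrec.snd.comp h)
        (Primrec.list_drop.comp (Primrec.const k) (Primrec.snd.comp Primrec.fst)) Primrec.snd
    · exact (primrec_codeStates.comp (Primrec.fst.comp Primrec.fst)).to_comp
  have hD : ComputablePred fun t : MullerCode S × ℕ =>
      ∃ w ∈ wordsOfLength letters (k + 2 * t.2), w ∈ language X ∧
        WindowInTable t.1 (k + t.2) t.2 w := by
    refine ComputablePred.exists_mem_list ?_ hwords.to_comp
    refine ComputablePred.and hlang ?_
    have hn : Primrec fun t : (MullerCode S × ℕ) × List S => t.1.2 :=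
      Primrec.snd.comp Primrec.fst
    exact computablePred_windowInTable (Primrec.fst.comp Primrec.fst)
      (Primrec.nat_add.comp (Primrec.const k) hn) hn Primrec.snd
  have hCiff : ∀ (c : MullerCode S) (n : ℕ), (∀ w ∈ wordsOfLength letters (k + 2 * n),
      ¬ (w ∈ language X ∧ ¬ ∀ q ∈ codeStates c, WindowsAgree c n (w.drop k) q)) ↔
      ∀ w ∈ language X, w.length = k + 2 * n → ∀ q ∈ codeStates c,
        WindowsAgree c n (w.drop k) q := fun c n => by
    simp only [mem_wordsOfLength hletters, not_and, not_not]
    exact ⟨fun h w hw hl => h w hl hw, fun h w hl hw => h w hw hl⟩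
  obtain ⟨P, hP, h⟩ := ComputablePred.of_search
    (D := fun c n => ∃ w ∈ wordsOfLength letters (k + 2 * n), w ∈ language X ∧
      WindowInTable c (k + n) n w) hC hD fun c =>
    (exists_windowsAgree hX hk).imp fun n => (hCiff c n).2
  refine ⟨P, hP, fun A c hA => ?_⟩
  obtain ⟨n, hn, hPn⟩ := h c
  rw [hPn, ← exists_congr fun x => and_congr_right fun _ => codeAccepts_iff hA x,
    exists_codeAccepts_iff hX ((hCiff c n).1 hn)]
  simp only [mem_wordsOfLength hletters]
  exact exists_congr fun w => and_left_comm

end Algorithm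

end OneSided

theorem mainTheorem4 {S : Type*} [Finite S] [Primcodable S]
    [TopologicalSpace S] [DiscreteTopology S]
    (X : Set (ℕ → S)) (hX : OneSided.IsSubshift X)
    (hrec : OneSided.IsRecursive X) (hq : OneSided.IsQuasiminimal X) :
    OneSided.IsDecidable X := by
  classical
  obtain ⟨k, hk⟩ := OneSided.exists_iterate_shift_windowed hX hq
  exact OneSided.isDecidable_of_windowed hX.2 hrec hk
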